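/- Let $k$ be a field, $A$ a finite-dimensional $k$-algebra, $Q$ a finite acyclic quiver with at least one vertex, and $I$ the two-sided ideal of the path algebra $kQ$ generated by a set $\rho$ of paths of length at least $2$. Paths are composed from right to left, and $s(\alpha)$, $e(\alpha)$ denote the starting and the ending vertex of an arrow $\alpha$. Let $\Lambda = A\otimes_k kQ/I$. A finitely generated left $\Lambda$-module $X$ is identified with the representation $(X_i, X_\alpha)$ of $(Q,I)$ over $A$ in which $X_i = (1\otimes e_i)X$ for each vertex $i$ and $X_\alpha\colon X_{s(\alpha)}\to X_{e(\alpha)}$ is the $A$-linear map given by multiplication by $1\otimes\alpha$ for each arrow $\alpha$. For a path $q=\alpha_l\cdots\alpha_1$ put $X_q = X_{\alpha_l}\cdots X_{\alpha_1}$. The module $X$ is called monic if (m1) for each vertex $i$, the sum $\sum_{e(\alpha)=i}\operatorname{Im} X_\alpha$ over all arrows $\alpha$ ending at $i$ is direct; and (m2) for each arrow $\alpha$, $\operatorname{Ker} X_\alpha = \sum_{q\in K_\alpha}\operatorname{Im} X_q$, where $K_\alpha$ is the set of all paths $q\notin I$ of length at least $1$ that end at $s(\alpha)$ and satisfy $\alpha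 q\in I$ (an empty sum is $0$). Then the monic $\Lambda$-modules are exactly the (finitely generated) projective $\Lambda$-modules if and only if $A$ is semisimple. In particular (the case $A=k$), the monic $kQ/I$-modules are exactly the finitely generated projective $kQ/I$-modules. -/

import Mathlib

open scoped TensorProduct

universe uk uA uQ vQ w

namespace BoundQuiver

/-! ### Paths and the path algebra -/

/-- A path of the quiver `Q`, together with its starting vertex `src` and its ending vertex `tgt`. -/
structure QPath (Q : Type uQ) [Quiver.{vQ} Q] where
  src : Q
  tgt : Q
  path : Quiver.Path src tgt

namespace QPath

variable {Q : Type uQ} [Quiver.{vQ} Q]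

/-- The length of a path. -/
def length (p : QPath Q) : ℕ := p.path.length

/-- The trivial path `e_v` of length `0`. -/
def triv (v : Q) : QPath Q := ⟨v, v, Quiver.Path.nil⟩

/-- An arrow, as a path of length `1`. -/
def arrow {i j : Q} (α : i ⟶ j) : QPath Q := ⟨i, j, α.toPath⟩

end QPath

/-- A quiver is acyclic if it has no closed path of positive length. -/
def IsAcyclic (Q : Type uQ) [Quiver.{vQ} Q] : Prop :=
  ∀ (i : Q) (p : Quiver.Path i i), p.length = 0

/-- The path algebra `kQ`: the `k`-vector space with basis the set of all paths of `Q`. -/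
def PathAlgebra (k : Type uk) [Field k] (Q : Type uQ) [Quiver.{vQ} Q] : Type (max uk uQ vQ) :=
  QPath Q →₀ k

namespace PathAlgebra

variable (k : Type uk) [Field k] {Q : Type uQ} [Quiver.{vQ} Q]

noncomputable instance : AddCommGroup (PathAlgebra k Q) :=
  inferInstanceAs (AddCommGroup (QPath Q →₀ k))

noncomputable instance : Module k (PathAlgebra k Q) :=
  inferInstanceAs (Module k (QPath Q →₀ k))

/-- The basis element of `kQ` given by a path. -/
noncomputable def of (p : QPath Q) : PathAlgebra k Q := Finsupp.single p (1 : k)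

open Classical in
/-- The product `p q` of two paths in `kQ`. Paths are connected from right to left: `p q` is the
path `q` followed by `p` if `q` ends where `p` starts, and `0` otherwise. -/
noncomputable def ofMul (p q : QPath Q) : PathAlgebra k Q :=
  if h : q.tgt = p.src then of k ⟨q.src, p.tgt, q.path.comp (p.path.cast h.symm rfl)⟩ else 0

/-- The bilinear extension of the product of paths. -/
noncomputable def mulLin : PathAlgebra k Q →ₗ[k] PathAlgebra k Q →ₗ[k] PathAlgebra k Q :=
  Finsupp.linearCombination k fun p : QPath Q =>
    (Finsupp.linearCombination k fun q : QPath Q => ofMul k p q :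
      (QPath Q →₀ k) →ₗ[k] PathAlgebra k Q)

noncomputable instance : Mul (PathAlgebra k Q) := ⟨fun x y => mulLin k x y⟩

variable {k} in
theorem mul_def (x y : PathAlgebra k Q) : x * y = mulLin k x y := rfl

theorem of_mul_of (p q : QPath Q) : of k p * of k q = ofMul k p q := by
  have h1 := Finsupp.linearCombination_single k (v := fun p : QPath Q =>
    (Finsupp.linearCombination k fun q : QPath Q => ofMul k p q :
      (QPath Q →₀ k) →ₗ[k] PathAlgebra k Q)) 1 p
  have h2 := Finsupp.linearCombination_single k (v := fun q : QPath Q => ofMul k p q) 1 q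
  rw [one_smul] at h1 h2
  exact (LinearMap.congr_fun h1 (Finsupp.single q 1)).trans h2

theorem of_mul_of_comp {a b c : Q} (q : Quiver.Path a b) (p : Quiver.Path b c) :
    of k ⟨b, c, p⟩ * of k ⟨a, b, q⟩ = of k ⟨a, c, q.comp p⟩ := by
  rw [of_mul_of, ofMul, dif_pos rfl]; rfl

theorem of_mul_of_ne {p q : QPath Q} (h : q.tgt ≠ p.src) : of k p * of k q = 0 := by
  rw [of_mul_of, ofMul, dif_neg h]

variable {k} in
theorem induction {P : PathAlgebra k Q → Prop} (x : PathAlgebra k Q) (h0 : P 0)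
    (hadd : ∀ x y, P x → P y → P (x + y)) (hof : ∀ (c : k) p, P (c • of k p)) : P x := by
  refine Finsupp.induction_linear (motive := P) x h0 hadd fun p c => ?_
  have : (Finsupp.single p c : QPath Q →₀ k) = c • Finsupp.single p 1 := by simp
  rw [this]; exact hof c p

theorem of_mul_assoc (p q r : QPath Q) :
    of k p * of k q * of k r = of k p * (of k q * of k r) := by
  have hz1 : ∀ x : PathAlgebra k Q, 0 * x = 0 := fun x => by simp [mul_def]
  have hz2 : ∀ x : PathAlgebra k Q, x * 0 = 0 := fun x => by simp [mul_def]
  obtain ⟨a, b, p⟩ := p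
  obtain ⟨c, d, q⟩ := q
  obtain ⟨e, f, r⟩ := r
  by_cases h1 : d = a
  · subst h1
    by_cases h2 : f = c
    · subst h2
      simp only [of_mul_of_comp, Quiver.Path.comp_assoc]
    · rw [of_mul_of_comp, of_mul_of_ne k (by exact h2), of_mul_of_ne k (by exact h2), hz2]
  · rw [of_mul_of_ne k (by exact h1), hz1]
    by_cases h2 : f = c
    · subst h2
      rw [of_mul_of_comp, of_mul_of_ne k (by exact h1)]
    · rw [of_mul_of_ne k (q := ⟨e, f, r⟩) (by exact h2), hz2]

noncomputable instance instNonUnitalRing : NonUnitalRing (PathAlgebra k Q) where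
  left_distrib x y z := by simp [mul_def]
  right_distrib x y z := by simp [mul_def]
  zero_mul x := by simp [mul_def]
  mul_zero x := by simp [mul_def]
  mul_assoc x y z := by
    have h : ∀ (c : k) (x y : PathAlgebra k Q), c • x * y = c • (x * y) :=
      fun c x y => by simp [mul_def]
    have h' : ∀ (c : k) (x y : PathAlgebra k Q), x * c • y = c • (x * y) :=
      fun c x y => by simp [mul_def]
    have ha : ∀ x y z : PathAlgebra k Q, (x + y) * z = x * z + y * z :=
      fun x y z => by simp [mul_def]
    have hb : ∀ x y z : PathAlgebra k Q, x * (y + z) = x * y + x * z :=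
      fun x y z => by simp [mul_def]
    have hz1 : ∀ x : PathAlgebra k Q, 0 * x = 0 := fun x => by simp [mul_def]
    have hz2 : ∀ x : PathAlgebra k Q, x * 0 = 0 := fun x => by simp [mul_def]
    induction x using induction with
    | h0 => simp only [hz1]
    | hadd _ _ h1 h2 => simp only [ha, h1, h2]
    | hof a p =>
      induction y using induction with
      | h0 => simp only [hz1, hz2]
      | hadd _ _ h1 h2 => simp only [ha, hb, h1, h2]
      | hof b q =>
        induction z using induction with
        | h0 => simp only [hz2]
        | hadd _ _ h1 h2 => simp only [hb, h1, h2]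
        | hof c r => simp only [h, h', of_mul_assoc]

/-- The identity of `kQ` is the sum of the trivial paths (`Q` has finitely many vertices). -/
noncomputable instance [Fintype Q] : One (PathAlgebra k Q) := ⟨∑ v : Q, of k (QPath.triv v)⟩

theorem one_def [Fintype Q] : (1 : PathAlgebra k Q) = ∑ v : Q, of k (QPath.triv v) := rfl

theorem smul_mul (c : k) (x y : PathAlgebra k Q) : c • x * y = c • (x * y) := by simp [mul_def]

theorem mul_smul' (c : k) (x y : PathAlgebra k Q) : x * c • y = c • (x * y) := by simp [mul_def]

theorem triv_mul_of (p : QPath Q) : of k (QPath.triv p.tgt) * of k p = of k p := by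
  obtain ⟨a, b, p⟩ := p
  exact of_mul_of_comp k p Quiver.Path.nil

theorem of_mul_triv (p : QPath Q) : of k p * of k (QPath.triv p.src) = of k p := by
  obtain ⟨a, b, p⟩ := p
  rw [QPath.triv, of_mul_of_comp, Quiver.Path.nil_comp]

noncomputable instance instRing [Fintype Q] : Ring (PathAlgebra k Q) where
  __ := instNonUnitalRing k
  one_mul x := by
    induction x using induction with
    | h0 => simp
    | hadd _ _ h1 h2 => rw [mul_add, h1, h2]
    | hof c p =>
      rw [mul_smul', one_def, Finset.sum_mul, Finset.sum_eq_single p.tgt, triv_mul_of]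
      · exact fun v _ hv => of_mul_of_ne k hv.symm
      · simp
  mul_one x := by
    induction x using induction with
    | h0 => simp
    | hadd _ _ h1 h2 => rw [add_mul, h1, h2]
    | hof c p =>
      rw [smul_mul, one_def, Finset.mul_sum, Finset.sum_eq_single p.src, of_mul_triv]
      · exact fun v _ hv => of_mul_of_ne k hv
      · simp

noncomputable instance [Fintype Q] : Algebra k (PathAlgebra k Q) :=
  Algebra.ofModule (smul_mul k) (fun c x y => mul_smul' k c x y)

end PathAlgebra

/-! ### Monomial relations and the algebras `kQ/I` and `A ⊗ kQ/I` -/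

section Algebras

variable (k : Type uk) [Field k] {Q : Type uQ} [Quiver.{vQ} Q] [Fintype Q]

/-- The two-sided ideal of `kQ` generated by a set `ρ` of paths. -/
noncomputable def monomialIdeal (ρ : Set (QPath Q)) : TwoSidedIdeal (PathAlgebra k Q) :=
  TwoSidedIdeal.span (PathAlgebra.of k '' ρ)

/-- The algebra `kQ/I`, where `I` is the ideal generated by the set `ρ` of paths. -/
abbrev BoundAlgebra (ρ : Set (QPath Q)) : Type (max uk uQ vQ) :=
  (monomialIdeal k ρ).ringCon.Quotient

/-- The class of a path in `kQ/I`. -/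
noncomputable def BoundAlgebra.of (ρ : Set (QPath Q)) (p : QPath Q) : BoundAlgebra k ρ :=
  (monomialIdeal k ρ).ringCon.mk' (PathAlgebra.of k p)

/-- The algebra `Λ = A ⊗ kQ/I`, the tensor product being over `k`. -/
abbrev TensorBoundAlgebra (A : Type uA) [Ring A] [Algebra k A] (ρ : Set (QPath Q)) :
    Type (max uA uk uQ vQ) :=
  A ⊗[k] BoundAlgebra k ρ

end Algebras

/-! ### Representations of quivers and monic representations -/

/-- A representation of the quiver `Q` over the ring `A`: an `A`-module for every vertex and an
`A`-linear map for every arrow. -/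
structure QuiverRep (A : Type uA) [Ring A] (Q : Type uQ) [Quiver.{vQ} Q] where
  obj : Q → Type w
  [addCommGroup : ∀ i, AddCommGroup (obj i)]
  [module : ∀ i, Module A (obj i)]
  map : ∀ {i j : Q}, (i ⟶ j) → (obj i →ₗ[A] obj j)

attribute [instance] QuiverRep.addCommGroup QuiverRep.module

namespace QuiverRep

section

variable {A : Type uA} [Ring A] {Q : Type uQ} [Quiver.{vQ} Q] (X : QuiverRep.{uA, uQ, vQ, w} A Q)

/-- The composite `X_p` of the structure maps along a path `p`. -/
def mapPath {i : Q} : ∀ {j : Q}, Quiver.Path i j → (X.obj i →ₗ[A] X.obj j)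
  | _, Quiver.Path.nil => LinearMap.id
  | _, Quiver.Path.cons p α => X.map α ∘ₗ mapPath p

/-- `X` is a representation of `(Q, I)`, where `I` is the ideal generated by the set `ρ` of paths:
`X_p = 0` for all `p` in `ρ`. -/
def IsBound (ρ : Set (QPath Q)) : Prop :=
  ∀ p ∈ ρ, X.mapPath p.path = 0

/-- For an arrow `α`, the set `K_α` of all paths `q` of positive length which end at the starting
vertex of `α`, are not in `I`, and satisfy `α q ∈ I`. -/
def K (k : Type uk) [Field k] [Fintype Q] (ρ : Set (QPath Q)) {i j : Q} (α : i ⟶ j) :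
    Set (QPath Q) :=
  {q | q.tgt = i ∧ 1 ≤ q.length ∧ PathAlgebra.of k q ∉ monomialIdeal k ρ ∧
    PathAlgebra.of k (QPath.arrow α) * PathAlgebra.of k q ∈ monomialIdeal k ρ}

/-- Monic representations of `(Q, I)` over `A`. -/
structure IsMonic (k : Type uk) [Field k] [Fintype Q] (ρ : Set (QPath Q)) : Prop where
  /-- `X` is a representation of `(Q, I)`. -/
  bound : X.IsBound ρ
  /-- For every vertex `i`, the sum of the images of the maps `X_α`, over all arrows `α` ending
  at `i`, is direct. -/
  m1 : ∀ i : Q, iSupIndep fun α : (Σ j : Q, (j ⟶ i)) => LinearMap.range (X.map α.2)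
  /-- For every arrow `α`, the kernel of `X_α` is the sum of the images of the `X_q`, `q ∈ K_α`. -/
  m2 : ∀ {i j : Q} (α : i ⟶ j), LinearMap.ker (X.map α) =
    ⨆ (h : Q) (q : Quiver.Path h i) (_ : (⟨h, i, q⟩ : QPath Q) ∈ K k ρ α),
      LinearMap.range (X.mapPath q)

end

section OfModule

variable (k : Type uk) [Field k] (A : Type uA) [Ring A] {Q : Type uQ} [Quiver.{vQ} Q] [Fintype Q]
  (ρ : Set (QPath Q))

/-- The representation of `Q` over `A` given by a module `M` over `A` and `kQ/I` with commuting
actions: `M_i = e_i M` and `M_α` is the multiplication by `α`. -/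
noncomputable def ofModules (M : Type w) [AddCommGroup M] [Module A M]
    [Module (BoundAlgebra k ρ) M] [SMulCommClass (BoundAlgebra k ρ) A M] :
    QuiverRep.{uA, uQ, vQ, w} A Q where
  obj i := LinearMap.range
    (DistribSMul.toLinearMap A M (BoundAlgebra.of k ρ (QPath.triv i)))
  map {i j} α := LinearMap.restrict
    (DistribSMul.toLinearMap A M (BoundAlgebra.of k ρ (QPath.arrow α))) (by
      intro x _
      refine ⟨BoundAlgebra.of k ρ (QPath.arrow α) • x, ?_⟩
      change BoundAlgebra.of k ρ (QPath.triv j) • BoundAlgebra.of k ρ (QPath.arrow α) • x =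
        BoundAlgebra.of k ρ (QPath.arrow α) • x
      rw [← mul_smul, BoundAlgebra.of, BoundAlgebra.of, ← map_mul]
      congr 2
      exact PathAlgebra.triv_mul_of k (QPath.arrow α))

/-- The representation of `Q` over `A` identified with a module over `Λ = A ⊗ kQ/I`. -/
noncomputable def ofTensorModule [Algebra k A] (M : Type w) [AddCommGroup M]
    [Module (TensorBoundAlgebra k A ρ) M] : QuiverRep.{uA, uQ, vQ, w} A Q :=
  letI : Module A M := Module.compHom M
    (Algebra.TensorProduct.includeLeft : A →ₐ[k] TensorBoundAlgebra k A ρ).toRingHom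
  letI : Module (BoundAlgebra k ρ) M := Module.compHom M
    (Algebra.TensorProduct.includeRight : BoundAlgebra k ρ →ₐ[k] TensorBoundAlgebra k A ρ).toRingHom
  haveI : SMulCommClass (BoundAlgebra k ρ) A M := ⟨fun b a x => by
    change ((1 : A) ⊗ₜ[k] b) • (a ⊗ₜ[k] (1 : BoundAlgebra k ρ)) • x =
      (a ⊗ₜ[k] (1 : BoundAlgebra k ρ)) • ((1 : A) ⊗ₜ[k] b) • x
    simp only [← mul_smul, Algebra.TensorProduct.tmul_mul_tmul, one_mul, mul_one]⟩
  ofModules k A ρ M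

/-- The representation of `Q` over `k` identified with a module over `kQ/I`. -/
noncomputable def ofBoundModule (N : Type w) [AddCommGroup N] [Module (BoundAlgebra k ρ) N] :
    QuiverRep.{uk, uQ, vQ, w} k Q :=
  letI : Module k N := Module.compHom N (algebraMap k (BoundAlgebra k ρ))
  haveI : SMulCommClass (BoundAlgebra k ρ) k N := ⟨fun b c x => by
    change b • algebraMap k (BoundAlgebra k ρ) c • x = algebraMap k (BoundAlgebra k ρ) c • b • x
    rw [← mul_smul, ← mul_smul, Algebra.commutes]⟩
  ofModules k k ρ N

end OfModule

end QuiverRep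

/-- A module over `Λ = A ⊗ kQ/I` is monic if the corresponding representation is monic. -/
def IsMonicTensorModule (k : Type uk) [Field k] (A : Type uA) [Ring A] [Algebra k A]
    {Q : Type uQ} [Quiver.{vQ} Q] [Fintype Q] (ρ : Set (QPath Q))
    (M : Type w) [AddCommGroup M] [Module (TensorBoundAlgebra k A ρ) M] : Prop :=
  (QuiverRep.ofTensorModule k A ρ M).IsMonic k ρ

/-- A module over `kQ/I` is monic if the corresponding representation over `k` is monic. -/
def IsMonicBoundModule (k : Type uk) [Field k]
    {Q : Type uQ} [Quiver.{vQ} Q] [Fintype Q] (ρ : Set (QPath Q))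
    (N : Type w) [AddCommGroup N] [Module (BoundAlgebra k ρ) N] : Prop :=
  (QuiverRep.ofBoundModule k ρ N).IsMonic k ρ

end BoundQuiver

/-! Both conditions on a monic module can be tested on elements, and they mention only the action of
`kQ/I` (`IsPathMonic`, `isMonic_ofModules_iff`); the coefficient ring `A` enters only in splitting.

Projective implies monic, for every `A`. The ideal `I` is spanned by the paths in it, so the regular
module is monic by inspecting coefficients of paths (`isPathMonic_self`). Being monic passes to
direct sums and retracts, and `A ⊗ kQ/I` is free over `kQ/I` on a `k`-basis of `A`.

Monic implies projective, for semisimple `A`. Every `Λ`-surjection `f : N → M` onto a monic `M`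
splits. Acyclicity ranks the vertices, and `A`-linear sections of `f` are built by increasing rank
(`exists_vertex_sections`). At a vertex `j`, compatibility with the arrows ending there prescribes
the section on the sum of the images `αM`; (m1) and (m2) are exactly what makes this prescription
well defined, and semisimplicity extends it to an `A`-linear section (`exists_section_extending`).
Gluing with the idempotents `e_i` gives a `Λ`-section. The case `A = k` is included, a field being
semisimple.

Conversely, an `A`-module placed at a sink is monic for trivial reasons. If monic modules are
projective, then `A → A/J`, placed at a sink, splits for every left ideal `J`, so `A` is semisimple.
-/

namespace BoundQuiver

/-! ### Coefficients of paths in the path algebra. -/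

namespace PathAlgebra

variable (k : Type uk) [Field k] {Q : Type uQ} [Quiver.{vQ} Q]

/-- The coefficient of a path in an element of the path algebra. -/
noncomputable def coeff (p : QPath Q) : PathAlgebra k Q →ₗ[k] k :=
  (Finsupp.lapply p : (QPath Q →₀ k) →ₗ[k] k)

open Classical in
theorem coeff_of (p q : QPath Q) : coeff k p (of k q) = if q = p then 1 else 0 :=
  Finsupp.single_apply

variable {k} in
theorem mem_span_of_iff {S : Set (QPath Q)} {x : PathAlgebra k Q} :
    x ∈ Submodule.span k (of k '' S) ↔ ∀ p, coeff k p x ≠ 0 → p ∈ S := by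
  have h := Finsupp.supported_eq_span_single k S
  change x ∈ Submodule.span k ((fun p => Finsupp.single p (1 : k)) '' S) ↔ _
  rw [← h]
  refine (Finsupp.mem_supported k (M := k) (s := S) x).trans ?_
  refine ⟨fun h p hp => h (Finsupp.mem_support_iff.2 hp), fun h p hp => h p ?_⟩
  exact Finsupp.mem_support_iff.1 hp

/-- Composition with `α` is injective on paths ending at `i`, so no two terms of `x` are merged. -/
theorem coeff_cons_arrow_mul {a i j : Q} (q : Quiver.Path a i) (α : i ⟶ j)
    (x : PathAlgebra k Q) :
    coeff k ⟨a, j, q.cons α⟩ (of k (QPath.arrow α) * x) = coeff k ⟨a, i, q⟩ x := by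
  classical
  induction x using induction with
  | h0 => simp
  | hadd x y hx hy => rw [mul_add, map_add, map_add, hx, hy]
  | hof c p =>
    rw [mul_smul', map_smul, map_smul]
    congr 1
    obtain ⟨b, d, p⟩ := p
    by_cases h : d = i
    · subst h
      rw [QPath.arrow, of_mul_of_comp, coeff_of, coeff_of]
      refine if_congr ⟨fun h => ?_, fun h => ?_⟩ rfl rfl
      · change (⟨b, j, p.cons α⟩ : QPath Q) = _ at h
        simp only [QPath.mk.injEq] at h
        obtain ⟨rfl, -, h⟩ := h
        simp only [heq_eq_eq, Quiver.Path.cons.injEq, true_and, and_true] at h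
        rw [h]
      · simp only [QPath.mk.injEq] at h
        obtain ⟨rfl, -, h⟩ := h
        rw [eq_of_heq h]
        rfl
    · rw [of_mul_of_ne k (by exact h), map_zero, coeff_of, if_neg]
      intro h'
      simp only [QPath.mk.injEq] at h'
      exact h h'.2.1

/-- Left multiples of distinct arrows therefore have disjoint supports, which is the source of (m1)
for `kQ/I`. -/
theorem exists_cons_of_coeff_arrow_mul_ne_zero {i j : Q} (α : i ⟶ j) (x : PathAlgebra k Q)
    {p : QPath Q} (h : coeff k p (of k (QPath.arrow α) * x) ≠ 0) :
    ∃ (a : Q) (q : Quiver.Path a i), p = ⟨a, j, q.cons α⟩ := by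
  classical
  by_contra hp
  refine h ?_
  clear h
  induction x using induction with
  | h0 => simp
  | hadd x y hx hy => rw [mul_add, map_add, hx, hy, add_zero]
  | hof c q =>
    rw [mul_smul', map_smul]
    obtain ⟨b, d, q⟩ := q
    by_cases h : d = i
    · subst h
      rw [QPath.arrow, of_mul_of_comp, coeff_of, if_neg, smul_zero]
      rintro rfl
      exact hp ⟨b, q, rfl⟩
    · rw [of_mul_of_ne k (by exact h), map_zero, smul_zero]

theorem triv_mul (v : Q) (x : PathAlgebra k Q) :
    of k (QPath.triv v) * x ∈ Submodule.span k (of k '' {p | p.tgt = v ∧ coeff k p x ≠ 0}) := by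
  classical
  rw [mem_span_of_iff]
  suffices h : ∀ p, coeff k p (of k (QPath.triv v) * x) = if p.tgt = v then coeff k p x else 0 by
    intro p hp
    rw [h] at hp
    exact ⟨by_contra fun h' => hp (if_neg h'), fun h' => hp (by rw [h', ite_self])⟩
  intro p
  induction x using induction with
  | h0 => simp
  | hadd x y hx hy => rw [mul_add, map_add, map_add, hx, hy]; split_ifs <;> simp
  | hof c q =>
    rw [mul_smul', map_smul, map_smul]
    by_cases h : q.tgt = v
    · subst h
      rw [triv_mul_of, coeff_of]
      split_ifs with h1 h2 <;> simp_all
    · rw [of_mul_of_ne k (by exact h), map_zero, smul_zero, coeff_of]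
      split_ifs with h1 h2 <;> simp_all

end PathAlgebra

/-! ### Monomial ideals and their quotients. -/

section Ideal

variable {k : Type uk} [Field k] {Q : Type uQ} [Quiver.{vQ} Q] [Fintype Q] {ρ : Set (QPath Q)}

open PathAlgebra

theorem smul_mem_monomialIdeal (c : k) {x : PathAlgebra k Q} (hx : x ∈ monomialIdeal k ρ) :
    c • x ∈ monomialIdeal k ρ := by
  rw [← one_mul x, ← PathAlgebra.smul_mul]
  exact (monomialIdeal k ρ).mul_mem_left _ _ hx

theorem mem_monomialIdeal_of_forall {x : PathAlgebra k Q}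
    (h : ∀ p, coeff k p x ≠ 0 → of k p ∈ monomialIdeal k ρ) : x ∈ monomialIdeal k ρ := by
  replace h := (mem_span_of_iff (S := {p | of k p ∈ monomialIdeal k ρ})).2 h
  induction h using Submodule.span_induction with
  | mem x hx => obtain ⟨p, hp, rfl⟩ := hx; exact hp
  | zero => exact zero_mem _
  | add x y _ _ hx hy => exact add_mem hx hy
  | smul c x _ hx => exact smul_mem_monomialIdeal c hx

/-- A set of paths which contains `ρ` and is closed under composition with arbitrary paths contains
all paths that occur in elements of the ideal generated by `ρ`. -/
theorem mem_of_coeff_ne_zero {S : Set (QPath Q)} (hρ : ρ ⊆ S)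
    (hl : ∀ p q, p ∈ S → ofMul k q p ∈ Submodule.span k (of k '' S))
    (hr : ∀ p q, p ∈ S → ofMul k p q ∈ Submodule.span k (of k '' S))
    {x : PathAlgebra k Q} (hx : x ∈ monomialIdeal k ρ) {p : QPath Q} (hp : coeff k p x ≠ 0) :
    p ∈ S := by
  set T := Submodule.span k (of k '' S) with hT
  -- The span `T` is stable under multiplication on both sides, hence is a two-sided ideal
  -- containing `ρ`.
  have hL : ∀ {y x : PathAlgebra k Q}, x ∈ T → y * x ∈ T := by
    intro y x hx
    induction y using induction with
    | h0 => rw [zero_mul]; exact zero_mem _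
    | hadd y z hy hz => rw [add_mul]; exact add_mem hy hz
    | hof c q =>
      rw [PathAlgebra.smul_mul]
      refine T.smul_mem c ?_
      induction hx using Submodule.span_induction with
      | mem x hx => obtain ⟨p, hp, rfl⟩ := hx; rw [of_mul_of]; exact hl p q hp
      | zero => rw [mul_zero]; exact zero_mem _
      | add x y _ _ hx hy => rw [mul_add]; exact add_mem hx hy
      | smul c x _ hx => rw [mul_smul']; exact T.smul_mem c hx
  have hR : ∀ {x y : PathAlgebra k Q}, x ∈ T → x * y ∈ T := by
    intro x y hx
    induction y using induction with
    | h0 => rw [mul_zero]; exact zero_mem _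
    | hadd y z hy hz => rw [mul_add]; exact add_mem hy hz
    | hof c q =>
      rw [mul_smul']
      refine T.smul_mem c ?_
      induction hx using Submodule.span_induction with
      | mem x hx => obtain ⟨p, hp, rfl⟩ := hx; rw [of_mul_of]; exact hr p q hp
      | zero => rw [zero_mul]; exact zero_mem _
      | add x y _ _ hx hy => rw [add_mul]; exact add_mem hx hy
      | smul c x _ hx => rw [PathAlgebra.smul_mul]; exact T.smul_mem c hx
  have hle : monomialIdeal k ρ ≤ TwoSidedIdeal.mk' (T : Set (PathAlgebra k Q)) T.zero_mem
      T.add_mem T.neg_mem hL hR := by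
    rw [monomialIdeal, TwoSidedIdeal.span_le, TwoSidedIdeal.coe_mk']
    exact (Set.image_mono hρ).trans Submodule.subset_span
  have hxT : x ∈ T := (TwoSidedIdeal.mem_mk' _ _ _ _ _ _ _).1 (hle hx)
  exact mem_span_of_iff.1 hxT p hp

/-- The ideal generated by a set of paths is spanned by the paths it contains. -/
theorem of_mem_monomialIdeal {x : PathAlgebra k Q} (hx : x ∈ monomialIdeal k ρ) {p : QPath Q}
    (hp : coeff k p x ≠ 0) : of k p ∈ monomialIdeal k ρ := by
  -- A product of two paths is a path or `0`, so once it lies in `I` it lies in the span of the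
  -- paths of `I`.
  have key : ∀ p q : QPath Q, ofMul k p q ∈ monomialIdeal k ρ →
      ofMul k p q ∈ Submodule.span k (of k '' {p | of k p ∈ monomialIdeal k ρ}) := by
    intro p q h
    unfold ofMul at h ⊢
    split_ifs at h ⊢ with h'
    · exact Submodule.subset_span ⟨_, h, rfl⟩
    · exact zero_mem _
  refine mem_of_coeff_ne_zero (S := {p | of k p ∈ monomialIdeal k ρ}) (fun p hp => ?_)
    (fun p q h => key _ _ ?_) (fun p q h => key _ _ ?_) hx hp
  · exact TwoSidedIdeal.subset_span ⟨p, hp, rfl⟩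
  · rw [← of_mul_of]; exact TwoSidedIdeal.mul_mem_left _ _ _ h
  · rw [← of_mul_of]; exact TwoSidedIdeal.mul_mem_right _ _ _ h

theorem le_length_of_mem_monomialIdeal {n : ℕ} (hρ : ∀ p ∈ ρ, n ≤ p.length)
    {x : PathAlgebra k Q} (hx : x ∈ monomialIdeal k ρ) {p : QPath Q} (hp : coeff k p x ≠ 0) :
    n ≤ p.length := by
  have key : ∀ p q : QPath Q, (n ≤ p.length ∨ n ≤ q.length) →
      ofMul k p q ∈ Submodule.span k (of k '' {p | n ≤ p.length}) := by
    rintro ⟨a, b, p⟩ ⟨c, d, q⟩ h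
    unfold ofMul
    split_ifs with h'
    · refine Submodule.subset_span ⟨_, ?_, rfl⟩
      change d = a at h'
      subst h'
      change n ≤ (q.comp p).length
      rw [Quiver.Path.length_comp]
      rcases h with h | h
      · exact le_trans h (Nat.le_add_left _ _)
      · exact le_trans h (Nat.le_add_right _ _)
    · exact zero_mem _
  exact mem_of_coeff_ne_zero (S := {p | n ≤ p.length}) hρ
    (fun p q h => key _ _ (.inr h)) (fun p q h => key _ _ (.inl h)) hx hp

theorem of_notMem_monomialIdeal (hρ : ∀ p ∈ ρ, 2 ≤ p.length) {p : QPath Q} (hp : p.length < 2) :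
    of k p ∉ monomialIdeal k ρ := fun h => by
  classical
  exact hp.not_ge (le_length_of_mem_monomialIdeal hρ h (p := p) (by simp [coeff_of]))

theorem BoundAlgebra.mk_eq_zero {x : PathAlgebra k Q} :
    (monomialIdeal k ρ).ringCon.mk' x = 0 ↔ x ∈ monomialIdeal k ρ := by
  rw [TwoSidedIdeal.mem_iff]
  exact RingCon.eq _

theorem BoundAlgebra.of_mul_of (p q : QPath Q) : BoundAlgebra.of k ρ p * BoundAlgebra.of k ρ q =
    (monomialIdeal k ρ).ringCon.mk' (PathAlgebra.of k p * PathAlgebra.of k q) :=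
  (map_mul _ _ _).symm

theorem BoundAlgebra.of_comp {a b c : Q} (q : Quiver.Path a b) (p : Quiver.Path b c) :
    BoundAlgebra.of k ρ ⟨a, c, q.comp p⟩ =
      BoundAlgebra.of k ρ ⟨b, c, p⟩ * BoundAlgebra.of k ρ ⟨a, b, q⟩ := by
  rw [BoundAlgebra.of_mul_of, of_mul_of_comp]; rfl

theorem BoundAlgebra.of_cons {a b c : Q} (q : Quiver.Path a b) (α : b ⟶ c) :
    BoundAlgebra.of k ρ ⟨a, c, q.cons α⟩ =
      BoundAlgebra.of k ρ (QPath.arrow α) * BoundAlgebra.of k ρ ⟨a, b, q⟩ :=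
  BoundAlgebra.of_comp q α.toPath

theorem BoundAlgebra.of_mul_of_ne {p q : QPath Q} (h : q.tgt ≠ p.src) :
    BoundAlgebra.of k ρ p * BoundAlgebra.of k ρ q = 0 := by
  rw [BoundAlgebra.of_mul_of, PathAlgebra.of_mul_of_ne k h, map_zero]

theorem BoundAlgebra.triv_mul_of (p : QPath Q) :
    BoundAlgebra.of k ρ (QPath.triv p.tgt) * BoundAlgebra.of k ρ p = BoundAlgebra.of k ρ p := by
  rw [BoundAlgebra.of_mul_of, PathAlgebra.triv_mul_of]; rfl

theorem BoundAlgebra.of_mul_triv (p : QPath Q) :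
    BoundAlgebra.of k ρ p * BoundAlgebra.of k ρ (QPath.triv p.src) = BoundAlgebra.of k ρ p := by
  rw [BoundAlgebra.of_mul_of, PathAlgebra.of_mul_triv]; rfl

theorem BoundAlgebra.sum_triv : ∑ v : Q, BoundAlgebra.of k ρ (QPath.triv v) = 1 := by
  unfold BoundAlgebra.of
  rw [← map_sum, ← PathAlgebra.one_def, map_one]

theorem BoundAlgebra.arrow_mul_of_K {i j : Q} {α : i ⟶ j} {q : QPath Q}
    (hq : q ∈ QuiverRep.K k ρ α) :
    BoundAlgebra.of k ρ (QPath.arrow α) * BoundAlgebra.of k ρ q = 0 := by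
  rw [BoundAlgebra.of_mul_of, BoundAlgebra.mk_eq_zero]
  exact hq.2.2.2

theorem BoundAlgebra.induction {P : BoundAlgebra k ρ → Prop} (b : BoundAlgebra k ρ) (h0 : P 0)
    (hadd : ∀ x y, P x → P y → P (x + y)) (hof : ∀ (c : k) p, P (c • BoundAlgebra.of k ρ p)) :
    P b := by
  obtain ⟨x, rfl⟩ := (monomialIdeal k ρ).ringCon.mk'_surjective b
  induction x using PathAlgebra.induction with
  | h0 => rwa [map_zero]
  | hadd x y hx hy => rw [map_add]; exact hadd _ _ hx hy
  | hof c p => exact hof c p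

end Ideal

/-! ### The elementwise monic conditions, and projective modules over `kQ/I`. -/

section PathMonic

variable (k : Type uk) [Field k] {Q : Type uQ} [Quiver.{vQ} Q] [Fintype Q] (ρ : Set (QPath Q))

/-- The sum of the images of the multiplications by the paths in `K_α`. -/
def imageSum (M : Type*) [AddCommGroup M] [Module (BoundAlgebra k ρ) M] {i j : Q} (α : i ⟶ j) :
    AddSubgroup M :=
  AddSubgroup.closure {y | ∃ q ∈ QuiverRep.K k ρ α, ∃ z : M, BoundAlgebra.of k ρ q • z = y}

/-- The elementwise form of the conditions on monic modules. It refers to the action of `kQ/I`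
only. -/
structure IsPathMonic (M : Type*) [AddCommGroup M] [Module (BoundAlgebra k ρ) M] : Prop where
  m1 : ∀ (j : Q) (s : Finset (Σ i : Q, (i ⟶ j))) (x : (Σ i : Q, (i ⟶ j)) → M),
    ∑ α ∈ s, BoundAlgebra.of k ρ (QPath.arrow α.2) • x α = 0 →
      ∀ α ∈ s, BoundAlgebra.of k ρ (QPath.arrow α.2) • x α = 0
  m2 : ∀ {i j : Q} (α : i ⟶ j) (x : M), BoundAlgebra.of k ρ (QPath.arrow α) • x = 0 →
    BoundAlgebra.of k ρ (QPath.triv i) • x ∈ imageSum k ρ M α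

variable {k ρ}

theorem map_mem_imageSum {M N : Type*} [AddCommGroup M] [Module (BoundAlgebra k ρ) M]
    [AddCommGroup N] [Module (BoundAlgebra k ρ) N] (f : M →ₗ[BoundAlgebra k ρ] N) {i j : Q}
    {α : i ⟶ j} {x : M} (hx : x ∈ imageSum k ρ M α) : f x ∈ imageSum k ρ N α := by
  induction hx using AddSubgroup.closure_induction with
  | mem x hx =>
    obtain ⟨q, hq, z, rfl⟩ := hx
    exact AddSubgroup.subset_closure ⟨q, hq, f z, (map_smul f _ _).symm⟩
  | zero => rw [map_zero]; exact zero_mem _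
  | add x y _ _ hx hy => rw [map_add]; exact add_mem hx hy
  | neg x _ hx => rw [map_neg]; exact neg_mem hx

/-- Push the hypotheses along `s`, apply the condition in `N`, and pull the conclusion back along
`r`. -/
theorem IsPathMonic.of_retract {M N : Type*} [AddCommGroup M] [Module (BoundAlgebra k ρ) M]
    [AddCommGroup N] [Module (BoundAlgebra k ρ) N] (hN : IsPathMonic k ρ N)
    (s : M →ₗ[BoundAlgebra k ρ] N) (r : N →ₗ[BoundAlgebra k ρ] M) (h : ∀ x, r (s x) = x) :
    IsPathMonic k ρ M where
  m1 j S x hx α hα := by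
    have := hN.m1 j S (fun α => s (x α))
      (by simp only [← map_smul, ← map_sum, hx, map_zero]) α hα
    rw [← h (_ • x α), map_smul, this, map_zero]
  m2 α x hx := by
    have := hN.m2 α (s x) (by rw [← map_smul, hx, map_zero])
    rw [← h (_ • x), map_smul]
    exact map_mem_imageSum r this

theorem IsPathMonic.finsupp {ι N : Type*} [AddCommGroup N] [Module (BoundAlgebra k ρ) N]
    (hN : IsPathMonic k ρ N) : IsPathMonic k ρ (ι →₀ N) where
  m1 j S x hx α hα := by
    ext t
    refine hN.m1 j S (fun α => x α t) ?_ α hα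
    simpa using DFunLike.congr_fun hx t
  m2 {i j} α x hx := by
    rw [← Finsupp.sum_single x, Finsupp.sum, Finset.smul_sum]
    refine sum_mem fun t _ => ?_
    have := hN.m2 α (x t) (by simpa using DFunLike.congr_fun hx t)
    rw [Finsupp.smul_single]
    exact map_mem_imageSum (Finsupp.lsingle t) this

open PathAlgebra in
-- Membership in `I` is decided path by path. For (m1), the terms of the sum have disjoint supports.
-- For (m2), each path `q` occurring in `e_i y` satisfies `αq ∈ I`, so it lies in `I` or in `K_α`.
theorem isPathMonic_self (hρ : ∀ p ∈ ρ, 2 ≤ p.length) :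
    IsPathMonic k ρ (BoundAlgebra k ρ) where
  m1 j S x hx α hα := by
    choose l hl using fun α => (monomialIdeal k ρ).ringCon.mk'_surjective (x α)
    have hsmul : ∀ α : Σ i : Q, (i ⟶ j), BoundAlgebra.of k ρ (QPath.arrow α.2) • x α =
        (monomialIdeal k ρ).ringCon.mk' (PathAlgebra.of k (QPath.arrow α.2) * l α) := by
      intro α
      rw [map_mul, hl]
      rfl
    simp only [hsmul, ← map_sum, BoundAlgebra.mk_eq_zero] at hx ⊢
    refine mem_monomialIdeal_of_forall fun p hp => of_mem_monomialIdeal hx ?_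
    rwa [map_sum, Finset.sum_eq_single_of_mem α hα]
    -- If a path occurs in two of the products, its last arrow identifies `β` with `α`.
    intro β _ hβ
    by_contra h
    obtain ⟨a, q, rfl⟩ := exists_cons_of_coeff_arrow_mul_ne_zero k _ _ hp
    obtain ⟨b, q', h'⟩ := exists_cons_of_coeff_arrow_mul_ne_zero k _ _ h
    refine hβ ?_
    simp only [QPath.mk.injEq] at h'
    obtain ⟨rfl, -, h'⟩ := h'
    simp only [heq_eq_eq, Quiver.Path.cons.injEq] at h'
    obtain ⟨α1, α2⟩ := α
    obtain ⟨β1, β2⟩ := β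
    obtain ⟨h1, -, h2⟩ := h'
    dsimp only at h1
    subst h1
    exact congrArg (Sigma.mk α1) (eq_of_heq h2).symm
  m2 {i j} α x hx := by
    obtain ⟨y, rfl⟩ := (monomialIdeal k ρ).ringCon.mk'_surjective x
    have hy : PathAlgebra.of k (QPath.arrow α) * y ∈ monomialIdeal k ρ := by
      rw [← BoundAlgebra.mk_eq_zero, map_mul]
      exact hx
    have h := triv_mul k i y
    change (monomialIdeal k ρ).ringCon.mk' (PathAlgebra.of k (QPath.triv i)) *
      (monomialIdeal k ρ).ringCon.mk' y ∈ _
    rw [← map_mul]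
    generalize PathAlgebra.of k (QPath.triv i) * y = w at h ⊢
    induction h using Submodule.span_induction with
    | zero => rw [map_zero]; exact zero_mem _
    | add x y _ _ hx hy => rw [map_add]; exact add_mem hx hy
    | smul c x _ hx =>
      -- `imageSum` is only an additive subgroup; a scalar is absorbed as right multiplication by `c
      -- • 1`, which is linear for the left module structure.
      have h : (monomialIdeal k ρ).ringCon.mk' (c • x) =
        (monomialIdeal k ρ).ringCon.mk' x * (monomialIdeal k ρ).ringCon.mk' (c • 1) := by
        rw [← map_mul, mul_smul', mul_one]
      rw [h]
      exact map_mem_imageSum (LinearMap.toSpanSingleton (BoundAlgebra k ρ) _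
        ((monomialIdeal k ρ).ringCon.mk' (c • 1))) hx
    | mem z hz =>
      obtain ⟨⟨a, b, q⟩, ⟨hb, hq⟩, rfl⟩ := hz
      dsimp only at hb
      subst hb
      by_cases hqI : of k ⟨a, b, q⟩ ∈ monomialIdeal k ρ
      · rw [BoundAlgebra.mk_eq_zero.2 hqI]
        exact zero_mem _
      · have hαq : of k ⟨a, j, q.cons α⟩ ∈ monomialIdeal k ρ :=
          of_mem_monomialIdeal hy (by rwa [coeff_cons_arrow_mul])
        refine AddSubgroup.subset_closure ⟨⟨a, b, q⟩, ⟨rfl, ?_, hqI, ?_⟩, 1, mul_one _⟩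
        -- For `q` trivial, `αq = α` would be a path of length `1` in `I`; this is where length at
        -- least `2` is used.
        · by_contra hlen
          refine of_notMem_monomialIdeal hρ ?_ hαq
          change q.length + 1 < 2
          change ¬ 1 ≤ q.length at hlen
          omega
        · rwa [QPath.arrow, of_mul_of_comp]

theorem isPathMonic_of_projective (hρ : ∀ p ∈ ρ, 2 ≤ p.length) {M : Type*} [AddCommGroup M]
    [Module (BoundAlgebra k ρ) M] [Module.Projective (BoundAlgebra k ρ) M] :
    IsPathMonic k ρ M := by
  obtain ⟨s, hs⟩ := Module.projective_def'.1 (inferInstance : Module.Projective (BoundAlgebra k ρ) M)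
  exact (isPathMonic_self hρ).finsupp.of_retract s
    (Finsupp.linearCombination (BoundAlgebra k ρ) id) (LinearMap.congr_fun hs)

end PathMonic

/-! ### Translation between representations and modules. -/

section OfModules

variable {k : Type uk} [Field k] {A : Type uA} [Ring A] {Q : Type uQ} [Quiver.{vQ} Q] [Fintype Q]
  {ρ : Set (QPath Q)} {M : Type w} [AddCommGroup M] [Module A M]
  [Module (BoundAlgebra k ρ) M] [SMulCommClass (BoundAlgebra k ρ) A M]

open QuiverRep

variable (k A ρ M) in
/-- The inclusion `e_i M → M`. -/
noncomputable def vertexVal (i : Q) : (ofModules k A ρ M).obj i →ₗ[A] M :=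
  (LinearMap.range (DistribSMul.toLinearMap A M (BoundAlgebra.of k ρ (QPath.triv i)))).subtype

theorem vertexVal_injective (i : Q) : Function.Injective (vertexVal k A ρ M i) :=
  Subtype.val_injective

variable (k A ρ) in
/-- The element `e_i x` of the vertex space `e_i M`. -/
noncomputable def toVertex (i : Q) (x : M) : (ofModules k A ρ M).obj i :=
  ⟨BoundAlgebra.of k ρ (QPath.triv i) • x, x, rfl⟩

theorem triv_smul_vertexVal {i : Q} (x : (ofModules k A ρ M).obj i) :
    BoundAlgebra.of k ρ (QPath.triv i) • vertexVal k A ρ M i x = vertexVal k A ρ M i x := by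
  obtain ⟨_, y, rfl⟩ := x
  change BoundAlgebra.of k ρ (QPath.triv i) • BoundAlgebra.of k ρ (QPath.triv i) • y =
    BoundAlgebra.of k ρ (QPath.triv i) • y
  rw [← mul_smul]
  congr 1
  exact BoundAlgebra.triv_mul_of (QPath.triv i)

theorem vertexVal_map {i j : Q} (α : i ⟶ j) (x : (ofModules k A ρ M).obj i) :
    vertexVal k A ρ M j ((ofModules k A ρ M).map α x) =
      BoundAlgebra.of k ρ (QPath.arrow α) • vertexVal k A ρ M i x :=
  rfl

theorem vertexVal_mapPath {i j : Q} (p : Quiver.Path i j) (x : (ofModules k A ρ M).obj i) :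
    vertexVal k A ρ M j ((ofModules k A ρ M).mapPath p x) =
      BoundAlgebra.of k ρ ⟨i, j, p⟩ • vertexVal k A ρ M i x := by
  induction p with
  | nil => exact (triv_smul_vertexVal x).symm
  | cons p α ih => rw [BoundAlgebra.of_cons, mul_smul, ← ih]; rfl

theorem of_smul_triv_smul (p : QPath Q) (x : M) :
    BoundAlgebra.of k ρ p • BoundAlgebra.of k ρ (QPath.triv p.src) • x =
      BoundAlgebra.of k ρ p • x := by
  rw [← mul_smul, BoundAlgebra.of_mul_triv]

theorem vertexVal_map_toVertex {i j : Q} (α : i ⟶ j) (x : M) :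
    vertexVal k A ρ M j ((ofModules k A ρ M).map α (toVertex k A ρ i x)) =
      BoundAlgebra.of k ρ (QPath.arrow α) • x :=
  (vertexVal_map α _).trans (of_smul_triv_smul (QPath.arrow α) x)

theorem vertexVal_mapPath_toVertex {i j : Q} (p : Quiver.Path i j) (x : M) :
    vertexVal k A ρ M j ((ofModules k A ρ M).mapPath p (toVertex k A ρ i x)) =
      BoundAlgebra.of k ρ ⟨i, j, p⟩ • x :=
  (vertexVal_mapPath p _).trans (of_smul_triv_smul ⟨i, j, p⟩ x)

theorem isBound_ofModules : (ofModules k A ρ M).IsBound ρ := by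
  intro p hp
  refine LinearMap.ext fun x => vertexVal_injective _ ?_
  have : BoundAlgebra.of k ρ p = 0 :=
    BoundAlgebra.mk_eq_zero.2 (TwoSidedIdeal.subset_span ⟨p, hp, rfl⟩)
  rw [LinearMap.zero_apply, map_zero]
  refine (vertexVal_mapPath p.path x).trans ?_
  change BoundAlgebra.of k ρ p • _ = _
  rw [this, zero_smul]

/-- Since `α = α e_i`, the image of `X_α` is all of `αM`, so arbitrary elements of `M` may replace
elements of the vertex spaces. -/
theorem iSupIndep_range_map_iff (j : Q) :
    (iSupIndep fun α : (Σ i : Q, (i ⟶ j)) => LinearMap.range ((ofModules k A ρ M).map α.2)) ↔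
    ∀ (s : Finset (Σ i : Q, (i ⟶ j))) (x : (Σ i : Q, (i ⟶ j)) → M),
      ∑ α ∈ s, BoundAlgebra.of k ρ (QPath.arrow α.2) • x α = 0 →
        ∀ α ∈ s, BoundAlgebra.of k ρ (QPath.arrow α.2) • x α = 0 := by
  rw [iSupIndep_iff_finsetSum_eq_zero_imp_eq_zero]
  refine ⟨fun h s x hx α hα => ?_, fun h s v hv hs α hα => ?_⟩
  · have := h s (fun α => (ofModules k A ρ M).map α.2 (toVertex k A ρ α.1 (x α)))
      (fun α _ => ⟨_, rfl⟩) (vertexVal_injective j ?_) α hα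
    · rw [← vertexVal_map_toVertex (A := A) α.2, this, map_zero]
    · simp only [map_sum, vertexVal_map_toVertex, hx, map_zero]
  -- Preimages matter only for arrows in `s`; elsewhere the choice is `0`.
  · have hv' : ∀ α, ∃ y : M, α ∈ s →
        BoundAlgebra.of k ρ (QPath.arrow α.2) • y = vertexVal k A ρ M j (v α) := by
      intro α
      by_cases hα : α ∈ s
      · obtain ⟨y, hy⟩ := hv α hα
        exact ⟨vertexVal k A ρ M _ y, fun _ => by rw [← hy, vertexVal_map]⟩
      · exact ⟨0, fun h => (hα h).elim⟩
    choose x hx using hv'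
    refine vertexVal_injective j ?_
    rw [← hx α hα, map_zero]
    refine h s x ?_ α hα
    rw [Finset.sum_congr rfl hx, ← map_sum, hs, map_zero]

variable (k A ρ M) in
/-- The sum of the images of the paths in `K_α`, as a submodule over `A`. -/
noncomputable def imageSubmodule {i j : Q} (α : i ⟶ j) : Submodule A M where
  __ := imageSum k ρ M α
  smul_mem' a x hx := by
    change x ∈ imageSum k ρ M α at hx
    change a • x ∈ imageSum k ρ M α
    induction hx using AddSubgroup.closure_induction with
    | mem x hx =>
      obtain ⟨q, hq, z, rfl⟩ := hx
      exact AddSubgroup.subset_closure ⟨q, hq, a • z, smul_comm _ _ _⟩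
    | zero => rw [smul_zero]; exact zero_mem _
    | add x y _ _ hx hy => rw [smul_add]; exact add_mem hx hy
    | neg x _ hx => rw [smul_neg]; exact neg_mem hx

/-- The additive closure is already `A`-stable because the two actions commute, so it matches the
supremum of `A`-submodules. -/
theorem mem_iSup_range_mapPath_iff {i j : Q} (α : i ⟶ j) (x : (ofModules k A ρ M).obj i) :
    (x ∈ ⨆ (h : Q) (q : Quiver.Path h i) (_ : (⟨h, i, q⟩ : QPath Q) ∈ K k ρ α),
      LinearMap.range ((ofModules k A ρ M).mapPath q)) ↔
      vertexVal k A ρ M i x ∈ imageSum k ρ M α := by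
  set T := ⨆ (h : Q) (q : Quiver.Path h i) (_ : (⟨h, i, q⟩ : QPath Q) ∈ K k ρ α),
    LinearMap.range ((ofModules k A ρ M).mapPath q) with hT
  constructor
  · suffices h : T ≤ (imageSubmodule k A ρ M α).comap (vertexVal k A ρ M i) from fun hx => h hx
    refine iSup_le fun h => iSup_le fun q => iSup_le fun hq => ?_
    rintro _ ⟨y, rfl⟩
    exact AddSubgroup.subset_closure ⟨_, hq, vertexVal k A ρ M h y, (vertexVal_mapPath q y).symm⟩
  · intro hx
    suffices h : imageSum k ρ M α ≤ (T.map (vertexVal k A ρ M i)).toAddSubgroup by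
      obtain ⟨y, hy, hyx⟩ := h hx
      rwa [← vertexVal_injective i hyx]
    refine (AddSubgroup.closure_le _).2 ?_
    rintro _ ⟨⟨a, b, q⟩, hq, z, rfl⟩
    obtain rfl : b = i := hq.1
    refine ⟨(ofModules k A ρ M).mapPath q (toVertex k A ρ a z), ?_,
      vertexVal_mapPath_toVertex q z⟩
    exact Submodule.mem_iSup_of_mem a (Submodule.mem_iSup_of_mem q
      (Submodule.mem_iSup_of_mem hq ⟨_, rfl⟩))

theorem arrow_smul_of_mem_imageSum {i j : Q} {α : i ⟶ j} {x : M} (hx : x ∈ imageSum k ρ M α) :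
    BoundAlgebra.of k ρ (QPath.arrow α) • x = 0 := by
  induction hx using AddSubgroup.closure_induction with
  | mem x hx =>
    obtain ⟨q, hq, z, rfl⟩ := hx
    rw [← mul_smul, BoundAlgebra.arrow_mul_of_K hq, zero_smul]
  | zero => rw [smul_zero]
  | add x y _ _ hx hy => rw [smul_add, hx, hy, add_zero]
  | neg x _ hx => rw [smul_neg, hx, neg_zero]

/-- The relations and the inclusion of the images in the kernel hold in every module, so
`IsPathMonic` records only (m1) and the other inclusion of (m2). The right side does not involve
`A`. -/
theorem isMonic_ofModules_iff : (ofModules k A ρ M).IsMonic k ρ ↔ IsPathMonic k ρ M := by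
  constructor
  · refine fun h => ⟨fun j => (iSupIndep_range_map_iff j).1 (h.m1 j), fun {i j} α x hx => ?_⟩
    refine (mem_iSup_range_mapPath_iff α (toVertex k A ρ i x)).1 ?_
    rw [← h.m2 α, LinearMap.mem_ker]
    refine vertexVal_injective j ?_
    rw [vertexVal_map_toVertex, hx, map_zero]
  · refine fun h => ⟨isBound_ofModules, fun j => (iSupIndep_range_map_iff j).2 (h.m1 j),
      fun {i j} α => ?_⟩
    ext x
    rw [mem_iSup_range_mapPath_iff, LinearMap.mem_ker, ← (vertexVal_injective j).eq_iff,
      vertexVal_map, map_zero]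
    refine ⟨fun hx => ?_, arrow_smul_of_mem_imageSum⟩
    rw [← triv_smul_vertexVal x]
    exact h.m2 α _ hx

end OfModules

/-! ### Ranks of vertices, and splitting surjections onto monic modules. -/

theorem IsAcyclic.exists_rank {Q : Type uQ} [Quiver.{vQ} Q] [Fintype Q] (hQ : IsAcyclic Q) :
    ∃ d : Q → ℕ, ∀ {i j : Q} (_ : i ⟶ j), d i < d j := by
  -- The rank counts the vertices with a path to `j`. It grows strictly along `α : i ⟶ j`: a path
  -- from `j` to `i` would close up to a cycle, so `j` itself is new.
  refine ⟨fun j => {i : Q | Nonempty (Quiver.Path i j)}.ncard, fun {i j} α => ?_⟩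
  refine Set.ncard_lt_ncard ⟨fun h ⟨p⟩ => ⟨p.cons α⟩, fun h => ?_⟩ (Set.toFinite _)
  obtain ⟨p⟩ := h (show Nonempty (Quiver.Path j j) from ⟨Quiver.Path.nil⟩)
  exact Nat.succ_ne_zero _ (hQ j (p.cons α))

theorem IsAcyclic.exists_sink {Q : Type uQ} [Quiver.{vQ} Q] [Fintype Q] [Nonempty Q]
    (hQ : IsAcyclic Q) : ∃ v : Q, ∀ j : Q, IsEmpty (v ⟶ j) := by
  obtain ⟨d, hd⟩ := hQ.exists_rank
  obtain ⟨v, hv⟩ := Finite.exists_max d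
  exact ⟨v, fun j => ⟨fun α => (hv j).not_gt (hd α)⟩⟩

/-- Over a semisimple ring, a compatible partial section of a surjection extends to a section. -/
theorem exists_section_extending {A : Type*} [Ring A] [IsSemisimpleRing A] {P M N : Type*}
    [AddCommGroup P] [Module A P] [AddCommGroup M] [Module A M] [AddCommGroup N] [Module A N]
    (f : N →ₗ[A] M) (hf : Function.Surjective f) (Φ : P →ₗ[A] M) (Ψ : P →ₗ[A] N)
    (hfΨ : ∀ x, f (Ψ x) = Φ x) (hker : ∀ x, Φ x = 0 → Ψ x = 0) :
    ∃ s : M →ₗ[A] N, (∀ x, f (s x) = x) ∧ ∀ x, s (Φ x) = Ψ x := by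
  obtain ⟨t, ht⟩ := IsSemisimpleModule.lifting_property f hf LinearMap.id
  -- `Φ` embeds `P / ker Φ` in `M`; `g` extends to `M` the map that `Ψ` induces on this quotient.
  obtain ⟨g, hg⟩ := IsSemisimpleModule.extension_property
    (Submodule.liftQ (LinearMap.ker Φ) Φ le_rfl)
    (LinearMap.ker_eq_bot.1 (Submodule.ker_liftQ_eq_bot _ _ _ le_rfl))
    (Submodule.liftQ (LinearMap.ker Φ) Ψ hker)
  have hgΦ : ∀ x, g (Φ x) = Ψ x := fun x => LinearMap.congr_fun hg (Submodule.Quotient.mk x)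
  have ht' : ∀ x, f (t x) = x := LinearMap.congr_fun ht
  -- `g` has the right values on the image of `Φ` but need not be a section. Subtracting `t ∘ f ∘ g`
  -- corrects this; on `Φ x` it cancels `t (Φ x)` because `f (g (Φ x)) = Φ x`.
  refine ⟨t + g - t ∘ₗ f ∘ₗ g, fun x => ?_, fun x => ?_⟩
  · simp [ht']
  · simp [hgΦ, hfΨ]

section Section

variable {k : Type uk} [Field k] {A : Type uA} [Ring A] {Q : Type uQ} [Quiver.{vQ} Q] [Fintype Q]
  {ρ : Set (QPath Q)} {M N : Type*} [AddCommGroup M] [Module A M] [Module (BoundAlgebra k ρ) M]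
  [AddCommGroup N] [Module A N] [Module (BoundAlgebra k ρ) N]

/-- Compatibility with arrows moves the sections past `q` one arrow at a time, exposing the factor
`αq`, which vanishes for `q ∈ K_α`. The leading `α` is needed since `s i` need not map `e_i M` into
`e_i N`; it absorbs the missing `e_i`. -/
theorem arrow_smul_section_path_smul (s : Q → M →ₗ[A] N) {d : Q → ℕ}
    (hd : ∀ {i j : Q} (_ : i ⟶ j), d i < d j) {n : ℕ}
    (hs : ∀ {i j : Q} (α : i ⟶ j), d j < n → ∀ x,
      s j (BoundAlgebra.of k ρ (QPath.arrow α) • x) =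
        BoundAlgebra.of k ρ (QPath.arrow α) • s i (BoundAlgebra.of k ρ (QPath.triv i) • x))
    {h i : Q} (q : Quiver.Path h i) {j : Q} (α : i ⟶ j) (hi : d i < n) (x : M) :
    BoundAlgebra.of k ρ (QPath.arrow α) • s i (BoundAlgebra.of k ρ ⟨h, i, q⟩ • x) =
      BoundAlgebra.of k ρ (QPath.arrow α) • BoundAlgebra.of k ρ ⟨h, i, q⟩ •
        s h (BoundAlgebra.of k ρ (QPath.triv h) • x) := by
  induction q generalizing j with
  | nil => exact (of_smul_triv_smul (QPath.arrow α) _).symm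
  | @cons b c q β ih =>
    rw [BoundAlgebra.of_cons, mul_smul, hs β hi, mul_smul, ← ih β ((hd β).trans hi)]
    congr 3
    rw [← mul_smul]
    congr 1
    exact BoundAlgebra.triv_mul_of ⟨h, b, q⟩

variable [IsSemisimpleRing A] [SMulCommClass (BoundAlgebra k ρ) A M]
  [SMulCommClass (BoundAlgebra k ρ) A N]

/-- Induction on the rank: the values of `s j` on the elements `αx` are dictated by sections at
vertices of smaller rank. -/
theorem exists_vertex_sections (hQ : IsAcyclic Q) (hM : IsPathMonic k ρ M) (f : N →ₗ[A] M)
    (hf : ∀ (b : BoundAlgebra k ρ) x, f (b • x) = b • f x) (hsurj : Function.Surjective f) :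
    ∃ s : Q → M →ₗ[A] N, (∀ i x, f (s i x) = x) ∧ ∀ {i j : Q} (α : i ⟶ j) (x : M),
      s j (BoundAlgebra.of k ρ (QPath.arrow α) • x) =
        BoundAlgebra.of k ρ (QPath.arrow α) • s i (BoundAlgebra.of k ρ (QPath.triv i) • x) := by
  obtain ⟨d, hd⟩ := hQ.exists_rank
  suffices H : ∀ n : ℕ, ∃ s : Q → M →ₗ[A] N, (∀ i x, f (s i x) = x) ∧
      ∀ {i j : Q} (α : i ⟶ j), d j < n → ∀ x,
      s j (BoundAlgebra.of k ρ (QPath.arrow α) • x) =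
        BoundAlgebra.of k ρ (QPath.arrow α) • s i (BoundAlgebra.of k ρ (QPath.triv i) • x) by
    obtain ⟨s, hs, hs'⟩ := H (∑ i, d i + 1)
    refine ⟨s, hs, fun {i j} α x => hs' α (Nat.lt_succ_of_le ?_) x⟩
    exact Finset.single_le_sum (f := d) (fun _ _ => Nat.zero_le _) (Finset.mem_univ j)
  intro n
  induction n with
  | zero =>
    obtain ⟨t, ht⟩ := IsSemisimpleModule.lifting_property f hsurj LinearMap.id
    exact ⟨fun _ => t, fun _ => LinearMap.congr_fun ht, fun _ h => (Nat.not_lt_zero _ h).elim⟩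
  | succ n ih =>
    obtain ⟨s, hfs, hs⟩ := ih
    -- Compatibility is stated against the old `s i`; as `i` has rank below `n`, where nothing
    -- changes, it can then be read with the new sections.
    have H : ∀ j, ∃ u : M →ₗ[A] N, (∀ x, f (u x) = x) ∧ (d j < n → u = s j) ∧
        (d j < n + 1 → ∀ {i : Q} (α : i ⟶ j) (x : M),
        u (BoundAlgebra.of k ρ (QPath.arrow α) • x) =
          BoundAlgebra.of k ρ (QPath.arrow α) •
            s i (BoundAlgebra.of k ρ (QPath.triv i) • x)) := by
      intro j
      by_cases hj : d j = n
      · let Φ : ((Σ i : Q, (i ⟶ j)) →₀ M) →ₗ[A] M := Finsupp.lsum ℕ fun α =>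
          DistribSMul.toLinearMap A M (BoundAlgebra.of k ρ (QPath.arrow α.2))
        let Ψ : ((Σ i : Q, (i ⟶ j)) →₀ M) →ₗ[A] N := Finsupp.lsum ℕ fun α =>
          DistribSMul.toLinearMap A N (BoundAlgebra.of k ρ (QPath.arrow α.2)) ∘ₗ s α.1 ∘ₗ
            DistribSMul.toLinearMap A M (BoundAlgebra.of k ρ (QPath.triv α.1))
        have hΦ : ∀ x, Φ x = ∑ α ∈ x.support, BoundAlgebra.of k ρ (QPath.arrow α.2) • x α :=
          fun x => rfl
        have hΨ : ∀ x, Ψ x = ∑ α ∈ x.support, BoundAlgebra.of k ρ (QPath.arrow α.2) •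
            s α.1 (BoundAlgebra.of k ρ (QPath.triv α.1) • x α) := fun x => rfl
        obtain ⟨u, hfu, hu⟩ := exists_section_extending f hsurj Φ Ψ
          (fun x => by
            rw [hΦ, hΨ, map_sum]
            refine Finset.sum_congr rfl fun α _ => ?_
            rw [hf, hfs]
            exact of_smul_triv_smul (QPath.arrow α.2) _)
          (fun x hx => by
            rw [hΨ]
            refine Finset.sum_eq_zero fun α hα => ?_
            -- Well-definedness: (m1) makes each `α x_α` zero, (m2) writes `e_i x_α` as a sum of
            -- elements `qz` with `q ∈ K_α`, and the section sends these to elements killed by `α`.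
            have h1 := hM.m1 j x.support x ((hΦ x).symm.trans hx) α hα
            have h2 := hM.m2 α.2 (x α) h1
            generalize BoundAlgebra.of k ρ (QPath.triv α.1) • x α = y at h2
            induction h2 using AddSubgroup.closure_induction with
            | mem y hy =>
              obtain ⟨⟨a, b, q⟩, hq, z, rfl⟩ := hy
              obtain rfl : b = α.1 := hq.1
              rw [arrow_smul_section_path_smul s hd hs q α.2 (hj ▸ hd α.2), ← mul_smul,
                BoundAlgebra.arrow_mul_of_K hq, zero_smul]
            | zero => rw [map_zero, smul_zero]
            | add y z _ _ hy hz => rw [map_add, smul_add, hy, hz, add_zero]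
            | neg y _ hy => rw [map_neg, smul_neg, hy, neg_zero])
        refine ⟨u, hfu, fun h => (h.ne hj).elim, fun _ {i} α x => ?_⟩
        have h1 : Φ (Finsupp.single ⟨i, α⟩ x) = BoundAlgebra.of k ρ (QPath.arrow α) • x :=
          Finsupp.sum_single_index (smul_zero _)
        have h2 : Ψ (Finsupp.single ⟨i, α⟩ x) = BoundAlgebra.of k ρ (QPath.arrow α) •
            s i (BoundAlgebra.of k ρ (QPath.triv i) • x) :=
          Finsupp.sum_single_index (LinearMap.map_zero _)
        rw [← h1, hu, h2]
      · exact ⟨s j, hfs j, fun _ => rfl, fun h {i} α =>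
          hs α (lt_of_le_of_ne (Nat.le_of_lt_succ h) hj)⟩
    choose u hfu hus hu using H
    refine ⟨u, hfu, fun {i j} α hj x => ?_⟩
    rw [hu j hj, hus i ((hd α).trans_le (Nat.le_of_lt_succ hj))]

/-- Over a semisimple ring, surjections onto monic modules split. -/
theorem exists_section_of_isPathMonic [Algebra k A] (hQ : IsAcyclic Q) (hM : IsPathMonic k ρ M)
    (hkM : ∀ (c : k) (x : M), algebraMap k (BoundAlgebra k ρ) c • x = algebraMap k A c • x)
    (hkN : ∀ (c : k) (x : N), algebraMap k (BoundAlgebra k ρ) c • x = algebraMap k A c • x)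
    (f : N →ₗ[A] M) (hf : ∀ (b : BoundAlgebra k ρ) x, f (b • x) = b • f x)
    (hsurj : Function.Surjective f) :
    ∃ s : M →ₗ[A] N, (∀ (b : BoundAlgebra k ρ) x, s (b • x) = b • s x) ∧ ∀ x, f (s x) = x := by
  classical
  obtain ⟨t, hft, ht⟩ := exists_vertex_sections hQ hM f hf hsurj
  let e : Q → BoundAlgebra k ρ := fun i => BoundAlgebra.of k ρ (QPath.triv i)
  -- Cutting each `t i` down to a map from `e_i M` to `e_i N` makes the sum commute with the trivial
  -- paths; compatibility then handles the arrows.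
  let s : M →ₗ[A] N := ∑ i, DistribSMul.toLinearMap A N (e i) ∘ₗ t i ∘ₗ
    DistribSMul.toLinearMap A M (e i)
  have hs : ∀ x, s x = ∑ i, e i • t i (e i • x) := fun x => by
    simp only [s, LinearMap.sum_apply]; rfl
  have he : ∀ (p : QPath Q) (x : M), BoundAlgebra.of k ρ p • x = e p.tgt • BoundAlgebra.of k ρ p • x :=
    fun p x => by rw [← mul_smul, BoundAlgebra.triv_mul_of]
  have hsl : ∀ (p : QPath Q) (x : M),
      s (BoundAlgebra.of k ρ p • x) = e p.tgt • t p.tgt (BoundAlgebra.of k ρ p • x) := by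
    intro p x
    rw [hs, Finset.sum_eq_single p.tgt, ← he]
    · intro v _ hv
      rw [← mul_smul (e v), BoundAlgebra.of_mul_of_ne (by exact hv.symm), zero_smul, map_zero,
        smul_zero]
    · simp
  have hsr : ∀ (p : QPath Q) (x : M),
      BoundAlgebra.of k ρ p • s x = BoundAlgebra.of k ρ p • t p.src (e p.src • x) := by
    intro p x
    rw [hs, Finset.smul_sum, Finset.sum_eq_single p.src, of_smul_triv_smul]
    · intro v _ hv
      rw [← mul_smul, BoundAlgebra.of_mul_of_ne (by exact hv), zero_smul]
    · simp
  have hsp : ∀ {i j : Q} (p : Quiver.Path i j) (x : M),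
      s (BoundAlgebra.of k ρ ⟨i, j, p⟩ • x) = BoundAlgebra.of k ρ ⟨i, j, p⟩ • s x := by
    intro i j p x
    induction p with
    | nil => rw [hsl, hsr]; rfl
    | @cons b c p α ih =>
      have hα : ∀ y, s (BoundAlgebra.of k ρ (QPath.arrow α) • y) =
          BoundAlgebra.of k ρ (QPath.arrow α) • s y := by
        intro y
        rw [hsl, hsr, QPath.arrow]
        change e c • t c (BoundAlgebra.of k ρ (QPath.arrow α) • y) = _
        rw [ht α, ← mul_smul]
        congr 1
        exact BoundAlgebra.triv_mul_of (QPath.arrow α)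
      rw [BoundAlgebra.of_cons, mul_smul, hα, ih, mul_smul]
  refine ⟨s, fun b x => ?_, fun x => ?_⟩
  · induction b using BoundAlgebra.induction with
    | h0 => rw [zero_smul, zero_smul, map_zero]
    | hadd b c hb hc => rw [add_smul, add_smul, map_add, hb, hc]
    | hof c p =>
      -- Scalars of `k` act in the same way through `A`, over which `s` is linear.
      rw [Algebra.smul_def, mul_smul, mul_smul, hkM, hkN, map_smul, hsp]
  · rw [hs, map_sum]
    simp only [hf, hft, ← mul_smul]
    rw [← Finset.sum_smul]
    have : ∑ i, e i * e i = 1 := by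
      rw [← BoundAlgebra.sum_triv]
      exact Finset.sum_congr rfl fun i _ => BoundAlgebra.triv_mul_of (QPath.triv i)
    rw [this, one_smul]

end Section

/-! ### Modules over `A ⊗ kQ/I`. -/

section Tensor

variable {k : Type uk} [Field k] {A : Type uA} [Ring A] [Algebra k A]
  {Q : Type uQ} [Quiver.{vQ} Q] [Fintype Q] {ρ : Set (QPath Q)}

/-- The action of `kQ/I` on a module over `A ⊗ kQ/I`. -/
noncomputable abbrev boundModule (M : Type*) [AddCommGroup M]
    [Module (TensorBoundAlgebra k A ρ) M] : Module (BoundAlgebra k ρ) M :=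
  Module.compHom M (Algebra.TensorProduct.includeRight :
    BoundAlgebra k ρ →ₐ[k] TensorBoundAlgebra k A ρ).toRingHom

/-- The action of `A` on a module over `A ⊗ kQ/I`. -/
noncomputable abbrev coefficientModule (M : Type*) [AddCommGroup M]
    [Module (TensorBoundAlgebra k A ρ) M] : Module A M :=
  Module.compHom M (Algebra.TensorProduct.includeLeft :
    A →ₐ[k] TensorBoundAlgebra k A ρ).toRingHom

theorem coefficient_smulCommClass (M : Type*) [AddCommGroup M]
    [Module (TensorBoundAlgebra k A ρ) M] :
    letI := coefficientModule (k := k) (A := A) (ρ := ρ) M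
    letI := boundModule (k := k) (A := A) (ρ := ρ) M
    SMulCommClass (BoundAlgebra k ρ) A M :=
  letI := coefficientModule (k := k) (A := A) (ρ := ρ) M
  letI := boundModule (k := k) (A := A) (ρ := ρ) M
  ⟨fun b a x => by
    change ((1 : A) ⊗ₜ[k] b) • (a ⊗ₜ[k] (1 : BoundAlgebra k ρ)) • x =
      (a ⊗ₜ[k] (1 : BoundAlgebra k ρ)) • ((1 : A) ⊗ₜ[k] b) • x
    simp only [← mul_smul, Algebra.TensorProduct.tmul_mul_tmul, one_mul, mul_one]⟩

theorem isMonicTensorModule_iff (M : Type w) [AddCommGroup M]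
    [Module (TensorBoundAlgebra k A ρ) M] :
    IsMonicTensorModule k A ρ M ↔
      (letI := boundModule (k := k) (A := A) (ρ := ρ) M; IsPathMonic k ρ M) :=
  letI := coefficientModule (k := k) (A := A) (ρ := ρ) M
  letI := boundModule (k := k) (A := A) (ρ := ρ) M
  haveI := coefficient_smulCommClass (k := k) (A := A) (ρ := ρ) M
  isMonic_ofModules_iff (k := k) (A := A) (ρ := ρ) (M := M)

/-- A `k`-basis of `A` makes `A ⊗ kQ/I` a free `kQ/I`-module. -/
theorem isPathMonic_tensorBoundAlgebra (hρ : ∀ p ∈ ρ, 2 ≤ p.length) :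
    letI := boundModule (k := k) (A := A) (ρ := ρ) (TensorBoundAlgebra k A ρ)
    IsPathMonic k ρ (TensorBoundAlgebra k A ρ) := by
  classical
  let := boundModule (k := k) (A := A) (ρ := ρ) (TensorBoundAlgebra k A ρ)
  let e := TensorProduct.equivFinsuppOfBasisLeft (N := BoundAlgebra k ρ)
    (Module.Basis.ofVectorSpace k A)
  have he : ∀ (b : BoundAlgebra k ρ) (x : TensorBoundAlgebra k A ρ), e (b • x) = b • e x := by
    intro b x
    change e ((1 : A) ⊗ₜ[k] b * x) = b • e x
    induction x using TensorProduct.induction_on with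
    | zero => rw [mul_zero, map_zero, smul_zero]
    | add x y hx hy => rw [mul_add, map_add, map_add, smul_add, hx, hy]
    | tmul a c =>
      rw [Algebra.TensorProduct.tmul_mul_tmul, one_mul]
      ext i
      simp [e]
  let e' : TensorBoundAlgebra k A ρ ≃ₗ[BoundAlgebra k ρ] _ →₀ BoundAlgebra k ρ :=
    { e.toAddEquiv with map_smul' := he }
  exact (isPathMonic_self hρ).finsupp.of_retract e'.toLinearMap e'.symm.toLinearMap
    e'.symm_apply_apply

theorem isMonicTensorModule_of_projective (hρ : ∀ p ∈ ρ, 2 ≤ p.length) (M : Type w)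
    [AddCommGroup M] [Module (TensorBoundAlgebra k A ρ) M]
    [Module.Projective (TensorBoundAlgebra k A ρ) M] : IsMonicTensorModule k A ρ M := by
  rw [isMonicTensorModule_iff]
  obtain ⟨s, hs⟩ := Module.projective_def'.1
    (inferInstance : Module.Projective (TensorBoundAlgebra k A ρ) M)
  let := boundModule (k := k) (A := A) (ρ := ρ) M
  let := boundModule (k := k) (A := A) (ρ := ρ) (TensorBoundAlgebra k A ρ)
  let r := Finsupp.linearCombination (TensorBoundAlgebra k A ρ) (id : M → M)
  refine (isPathMonic_tensorBoundAlgebra (A := A) hρ).finsupp.of_retract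
    { s.toAddHom with map_smul' := fun b x => ?_ }
    { r.toAddHom with map_smul' := fun b x => ?_ } (LinearMap.congr_fun hs)
  · exact s.map_smul ((1 : A) ⊗ₜ[k] b) x
  · exact r.map_smul ((1 : A) ⊗ₜ[k] b) x

theorem exists_section_of_isMonicTensorModule [IsSemisimpleRing A] (hQ : IsAcyclic Q) {M : Type*}
    [AddCommGroup M] [Module (TensorBoundAlgebra k A ρ) M] (hM : IsMonicTensorModule k A ρ M)
    {N : Type*} [AddCommGroup N] [Module (TensorBoundAlgebra k A ρ) N]
    (f : N →ₗ[TensorBoundAlgebra k A ρ] M) (hf : Function.Surjective f) :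
    ∃ s : M →ₗ[TensorBoundAlgebra k A ρ] N, f ∘ₗ s = LinearMap.id := by
  rw [isMonicTensorModule_iff] at hM
  let := boundModule (k := k) (A := A) (ρ := ρ) M
  let := boundModule (k := k) (A := A) (ρ := ρ) N
  let := coefficientModule (k := k) (A := A) (ρ := ρ) M
  let := coefficientModule (k := k) (A := A) (ρ := ρ) N
  have := coefficient_smulCommClass (k := k) (A := A) (ρ := ρ) M
  have := coefficient_smulCommClass (k := k) (A := A) (ρ := ρ) N
  have hk : ∀ c : k, (1 : A) ⊗ₜ[k] algebraMap k (BoundAlgebra k ρ) c =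
      algebraMap k A c ⊗ₜ[k] (1 : BoundAlgebra k ρ) := fun c => by
    rw [Algebra.algebraMap_eq_smul_one, Algebra.algebraMap_eq_smul_one, TensorProduct.smul_tmul]
  obtain ⟨s, hs, hfs⟩ := exists_section_of_isPathMonic (k := k) (A := A) (ρ := ρ) hQ hM
    (fun c x => congrArg (· • x) (hk c)) (fun c x => congrArg (· • x) (hk c))
    { f.toAddHom with map_smul' := fun a x => f.map_smul (a ⊗ₜ[k] (1 : BoundAlgebra k ρ)) x }
    (fun b x => f.map_smul ((1 : A) ⊗ₜ[k] b) x) hf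
  refine ⟨{ s.toAddHom with map_smul' := fun l x => ?_ }, LinearMap.ext hfs⟩
  change s (l • x) = l • s x
  induction l using TensorProduct.induction_on with
  | zero =>
    exact (congrArg s (zero_smul (TensorBoundAlgebra k A ρ) x)).trans
      ((map_zero s).trans (zero_smul (TensorBoundAlgebra k A ρ) (s x)).symm)
  | add l m hl hm => rw [add_smul, add_smul, map_add, hl, hm]
  | tmul a b =>
    -- Commuting with `A` and with `kQ/I` suffices, since pure tensors factor this way.
    have h : a ⊗ₜ[k] b = (a ⊗ₜ[k] (1 : BoundAlgebra k ρ)) * ((1 : A) ⊗ₜ[k] b) := by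
      rw [Algebra.TensorProduct.tmul_mul_tmul, one_mul, mul_one]
    rw [h, mul_smul, mul_smul]
    exact (s.map_smul a (b • x)).trans (congrArg (a • ·) (hs b x))

theorem projective_of_isMonicTensorModule [IsSemisimpleRing A] (hQ : IsAcyclic Q) (M : Type w)
    [AddCommGroup M] [Module (TensorBoundAlgebra k A ρ) M] (hM : IsMonicTensorModule k A ρ M) :
    Module.Projective (TensorBoundAlgebra k A ρ) M :=
  .of_lifting_property'' fun f hf =>
    exists_section_of_isMonicTensorModule (N := M →₀ TensorBoundAlgebra k A ρ) hQ hM f hf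

end Tensor

/-! ### The case `A = k`. -/

section Bound

variable {k : Type uk} [Field k] {Q : Type uQ} [Quiver.{vQ} Q] [Fintype Q] {ρ : Set (QPath Q)}

theorem scalar_smulCommClass (N : Type*) [AddCommGroup N] [Module (BoundAlgebra k ρ) N] :
    letI : Module k N := Module.compHom N (algebraMap k (BoundAlgebra k ρ))
    SMulCommClass (BoundAlgebra k ρ) k N :=
  letI : Module k N := Module.compHom N (algebraMap k (BoundAlgebra k ρ))
  ⟨fun b c x => by
    change b • algebraMap k (BoundAlgebra k ρ) c • x = algebraMap k (BoundAlgebra k ρ) c • b • x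
    rw [← mul_smul, ← mul_smul, Algebra.commutes]⟩

theorem isMonicBoundModule_iff (N : Type w) [AddCommGroup N] [Module (BoundAlgebra k ρ) N] :
    IsMonicBoundModule k ρ N ↔ IsPathMonic k ρ N :=
  letI : Module k N := Module.compHom N (algebraMap k (BoundAlgebra k ρ))
  haveI := scalar_smulCommClass (k := k) (ρ := ρ) N
  isMonic_ofModules_iff (k := k) (A := k) (ρ := ρ) (M := N)

theorem exists_section_of_isPathMonic_bound (hQ : IsAcyclic Q) {M : Type*}
    [AddCommGroup M] [Module (BoundAlgebra k ρ) M] (hM : IsPathMonic k ρ M)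
    {N : Type*} [AddCommGroup N] [Module (BoundAlgebra k ρ) N]
    (f : N →ₗ[BoundAlgebra k ρ] M) (hf : Function.Surjective f) :
    ∃ s : M →ₗ[BoundAlgebra k ρ] N, f ∘ₗ s = LinearMap.id := by
  let : Module k M := Module.compHom M (algebraMap k (BoundAlgebra k ρ))
  let : Module k N := Module.compHom N (algebraMap k (BoundAlgebra k ρ))
  have := scalar_smulCommClass (k := k) (ρ := ρ) M
  have := scalar_smulCommClass (k := k) (ρ := ρ) N
  obtain ⟨s, hs, hfs⟩ := exists_section_of_isPathMonic (k := k) (A := k) (ρ := ρ) hQ hM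
    (fun c x => rfl) (fun c x => rfl)
    { f.toAddHom with map_smul' := fun c x => f.map_smul (algebraMap k (BoundAlgebra k ρ) c) x }
    f.map_smul hf
  exact ⟨{ s.toAddHom with map_smul' := hs }, LinearMap.ext hfs⟩

theorem isMonicBoundModule_iff_projective (hQ : IsAcyclic Q) (hρ : ∀ p ∈ ρ, 2 ≤ p.length)
    (N : Type w) [AddCommGroup N] [Module (BoundAlgebra k ρ) N] :
    IsMonicBoundModule k ρ N ↔ Module.Projective (BoundAlgebra k ρ) N := by
  rw [isMonicBoundModule_iff]
  exact ⟨fun h => .of_lifting_property'' fun f hf => exists_section_of_isPathMonic_bound hQ h f hf,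
    fun _ => isPathMonic_of_projective hρ⟩

end Bound

/-! ### Characters at vertices, modules at a sink, and semisimplicity of `A`. -/

section Character

variable {k : Type uk} [Field k] {Q : Type uQ} [Quiver.{vQ} Q] [Fintype Q] {ρ : Set (QPath Q)}

open PathAlgebra

theorem coeff_triv_of_pos {Q : Type uQ} [Quiver.{vQ} Q] (v : Q) {p : QPath Q} (hp : 0 < p.length) :
    coeff k (QPath.triv v) (of k p) = 0 := by
  classical
  rw [coeff_of, if_neg]
  rintro rfl
  exact lt_irrefl 0 hp

/-- Lengths add under composition, so a product of two paths is `e_v` only if both factors are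
`e_v`. -/
theorem coeff_triv_mul (v : Q) (x y : PathAlgebra k Q) :
    coeff k (QPath.triv v) (x * y) = coeff k (QPath.triv v) x * coeff k (QPath.triv v) y := by
  classical
  induction x using PathAlgebra.induction with
  | h0 => simp
  | hadd x x' hx hx' => rw [add_mul, map_add, map_add, add_mul, hx, hx']
  | hof c p =>
    induction y using PathAlgebra.induction with
    | h0 => simp
    | hadd y y' hy hy' => rw [mul_add, map_add, map_add, mul_add, hy, hy']
    | hof d q =>
      rw [PathAlgebra.smul_mul, mul_smul', map_smul, map_smul, map_smul, map_smul, smul_mul_smul,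
        mul_smul]
      congr 2
      obtain ⟨a, b, p⟩ := p
      obtain ⟨a', b', q⟩ := q
      by_cases h : b' = a
      · subst h
        rw [of_mul_of_comp]
        cases p with
        | nil =>
          change _ = coeff k (QPath.triv v) (of k (QPath.triv b)) * _
          by_cases hv : b = v
          · subst hv
            rw [coeff_of k _ (QPath.triv b), if_pos rfl, one_mul]
            rfl
          · have h : ∀ q : QPath Q, q.tgt = b → coeff k (QPath.triv v) (of k q) = 0 := by
              intro q hq
              rw [coeff_of, if_neg]
              exact fun h => hv (hq.symm.trans (congrArg QPath.tgt h))
            rw [h (QPath.triv b) rfl, zero_mul]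
            exact h _ rfl
        | cons p α =>
          rw [coeff_triv_of_pos v (p := ⟨b', b, p.cons α⟩) (Nat.succ_pos _), zero_mul]
          exact coeff_triv_of_pos v (Nat.succ_pos _)
      · rw [of_mul_of_ne k (by exact h), map_zero, coeff_of, coeff_of]
        split_ifs with h1 h2
        · exact (h ((congrArg QPath.tgt h2).trans (congrArg QPath.src h1).symm)).elim
        all_goals simp

/-- The character of `kQ` which is `1` on `e_v` and `0` on all other paths. -/
noncomputable def pathCharacter (k : Type uk) [Field k] (v : Q) : PathAlgebra k Q →ₐ[k] k :=
  AlgHom.ofLinearMap (coeff k (QPath.triv v))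
    (by
      classical
      rw [one_def, map_sum, Finset.sum_eq_single v]
      · rw [coeff_of]; exact if_pos rfl
      · intro w _ hw
        rw [coeff_of, if_neg]
        exact fun h => hw (congrArg QPath.src h)
      · simp)
    (coeff_triv_mul v)

/-- The character of `kQ/I` which is `1` on `e_v` and `0` on all other paths. -/
noncomputable def boundCharacter (hρ : ∀ p ∈ ρ, 2 ≤ p.length) (v : Q) : BoundAlgebra k ρ →ₐ[k] k :=
  (monomialIdeal k ρ).ringCon.liftₐ (pathCharacter k v) fun x y h => by
    rw [TwoSidedIdeal.rel_iff] at h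
    change pathCharacter k v x = pathCharacter k v y
    rw [← sub_eq_zero, ← map_sub]
    by_contra h'
    -- Only paths of length at least `2` occur in elements of `I`, whereas `e_v` has length `0`.
    have := le_length_of_mem_monomialIdeal hρ h h'
    exact absurd this (Nat.not_succ_le_zero 1)

theorem boundCharacter_of (hρ : ∀ p ∈ ρ, 2 ≤ p.length) (v : Q) (p : QPath Q) :
    boundCharacter (k := k) hρ v (BoundAlgebra.of k ρ p) = coeff k (QPath.triv v) (of k p) :=
  rfl

variable {A : Type uA} [Ring A] [Algebra k A]

/-- The surjection of `A ⊗ kQ/I` onto `A` at the vertex `v`. -/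
noncomputable def vertexEval (A : Type uA) [Ring A] [Algebra k A] (hρ : ∀ p ∈ ρ, 2 ≤ p.length)
    (v : Q) : TensorBoundAlgebra k A ρ →ₐ[k] A :=
  (Algebra.TensorProduct.rid k k A).toAlgHom.comp
    (Algebra.TensorProduct.map (AlgHom.id k A) (boundCharacter hρ v))

theorem vertexEval_tmul (hρ : ∀ p ∈ ρ, 2 ≤ p.length) (v : Q) (a : A) (b : BoundAlgebra k ρ) :
    vertexEval A hρ v (a ⊗ₜ[k] b) = boundCharacter hρ v b • a := by
  simp [vertexEval]

/-- Modules over `A` which are concentrated in a sink are monic. -/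
theorem isMonicTensorModule_compHom_vertexEval (hρ : ∀ p ∈ ρ, 2 ≤ p.length) {v : Q}
    (hv : ∀ j : Q, IsEmpty (v ⟶ j)) (M : Type w) [AddCommGroup M] [Module A M] :
    letI : Module (TensorBoundAlgebra k A ρ) M :=
      Module.compHom M (vertexEval A hρ v).toRingHom
    IsMonicTensorModule k A ρ M := by
  classical
  let : Module (TensorBoundAlgebra k A ρ) M := Module.compHom M (vertexEval A hρ v).toRingHom
  rw [isMonicTensorModule_iff]
  let := boundModule (k := k) (A := A) (ρ := ρ) M
  -- Every path other than `e_v` acts as zero. So all arrows vanish, giving (m1); and no arrow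
  -- starts at the sink `v`, so in (m2) the idempotent `e_i` acts as zero.
  have key : ∀ (p : QPath Q) (x : M), coeff k (QPath.triv v) (of k p) = 0 →
      BoundAlgebra.of k ρ p • x = 0 := by
    intro p x hp
    change vertexEval A hρ v ((1 : A) ⊗ₜ[k] BoundAlgebra.of k ρ p) • x = 0
    rw [vertexEval_tmul, boundCharacter_of, hp, zero_smul, zero_smul]
  refine ⟨fun j s x _ α _ => key _ _ (coeff_triv_of_pos v Nat.one_pos), fun {i j} α x _ => ?_⟩
  rw [key]
  · exact zero_mem _
  · rw [coeff_of, if_neg]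
    intro h
    obtain rfl : i = v := congrArg QPath.src h
    exact (hv j).false α

/-- The map `id - s ∘ J.mkQ` projects `A` onto `J`, so every left ideal has a complement. -/
theorem isSemisimpleRing_of_quotient_sections
    (h : ∀ J : Submodule A A, ∃ s : (A ⧸ J) →ₗ[A] A, ∀ x, J.mkQ (s x) = x) :
    IsSemisimpleRing A := by
  refine (isSemisimpleModule_iff A A).2 ⟨fun J => ?_⟩
  obtain ⟨s, hs⟩ := h J
  have hmem : ∀ x, ((LinearMap.id : A →ₗ[A] A) - s ∘ₗ J.mkQ) x ∈ J := fun x => by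
    rw [← Submodule.Quotient.mk_eq_zero J]
    change J.mkQ (x - s (J.mkQ x)) = 0
    rw [map_sub, hs, sub_self]
  refine ⟨_, LinearMap.isCompl_of_proj (f := (LinearMap.id - s ∘ₗ J.mkQ).codRestrict J hmem)
    fun x => Subtype.ext ?_⟩
  have hx : J.mkQ x = 0 := (Submodule.Quotient.mk_eq_zero J).2 x.2
  change (x : A) - s (J.mkQ x) = x
  rw [hx, map_zero, sub_zero]

end Character

end BoundQuiver

/-! ### The main theorem. -/

theorem corollary4p3 (k : Type uk) [Field k]
    (A : Type uA) [Ring A] [Algebra k A] [Module.Finite k A]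
    (Q : Type uQ) [Quiver.{vQ} Q] [Fintype Q] [Nonempty Q] [∀ i j : Q, Finite (i ⟶ j)]
    (hQ : BoundQuiver.IsAcyclic Q)
    (ρ : Set (BoundQuiver.QPath Q)) (hρ : ∀ p ∈ ρ, 2 ≤ p.length) :
    ((∀ (M : Type (max uk uA uQ vQ)) [AddCommGroup M]
        [Module (BoundQuiver.TensorBoundAlgebra k A ρ) M]
        [Module.Finite (BoundQuiver.TensorBoundAlgebra k A ρ) M],
        BoundQuiver.IsMonicTensorModule k A ρ M ↔
          Module.Projective (BoundQuiver.TensorBoundAlgebra k A ρ) M) ↔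
      IsSemisimpleRing A) ∧
    (∀ (N : Type (max uk uQ vQ)) [AddCommGroup N] [Module (BoundQuiver.BoundAlgebra k ρ) N]
        [Module.Finite (BoundQuiver.BoundAlgebra k ρ) N],
        BoundQuiver.IsMonicBoundModule k ρ N ↔
          Module.Projective (BoundQuiver.BoundAlgebra k ρ) N) := by
  refine ⟨⟨fun H => ?_, fun _ M _ _ _ =>
    ⟨BoundQuiver.projective_of_isMonicTensorModule hQ M,
      fun _ => BoundQuiver.isMonicTensorModule_of_projective hρ M⟩⟩,
    fun N _ _ _ => BoundQuiver.isMonicBoundModule_iff_projective hQ hρ N⟩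
  obtain ⟨v, hv⟩ := hQ.exists_sink
  refine BoundQuiver.isSemisimpleRing_of_quotient_sections fun J => ?_
  -- The lift puts `A ⧸ J` in the universe over which the hypothesis quantifies.
  let M := ULift.{max uk uQ vQ} (A ⧸ J)
  let π := BoundQuiver.vertexEval (k := k) A hρ v
  let : Module (BoundQuiver.TensorBoundAlgebra k A ρ) A := Module.compHom A π.toRingHom
  let : Module (BoundQuiver.TensorBoundAlgebra k A ρ) M := Module.compHom M π.toRingHom
  let f : A →ₗ[BoundQuiver.TensorBoundAlgebra k A ρ] M :=
    { toFun a := ULift.up (J.mkQ a)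
      map_add' a b := congrArg ULift.up (J.mkQ.map_add a b)
      map_smul' l a := congrArg ULift.up (J.mkQ.map_smul (π l) a) }
  have hf : Function.Surjective f := fun ⟨x⟩ => by
    obtain ⟨a, ha⟩ := J.mkQ_surjective x
    exact ⟨a, congrArg ULift.up ha⟩
  have hπ : ∀ a : A, π (a ⊗ₜ[k] 1) = a := fun a => by
    rw [BoundQuiver.vertexEval_tmul, map_one, one_smul]
  -- `A` is generated by `1`, since `Λ` acts through the surjection `π`.
  have : Module.Finite (BoundQuiver.TensorBoundAlgebra k A ρ) A :=
    .of_surjective (LinearMap.toSpanSingleton _ A (1 : A)) fun a =>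
      ⟨a ⊗ₜ[k] 1, (mul_one (π (a ⊗ₜ[k] 1))).trans (hπ a)⟩
  have : Module.Finite (BoundQuiver.TensorBoundAlgebra k A ρ) M := .of_surjective f hf
  have : Module.Projective (BoundQuiver.TensorBoundAlgebra k A ρ) M :=
    (H M).1 (BoundQuiver.isMonicTensorModule_compHom_vertexEval hρ hv M)
  obtain ⟨s, hs⟩ := Module.projective_lifting_property f LinearMap.id hf
  refine ⟨{ toFun x := s (ULift.up x)
            map_add' x y := s.map_add (ULift.up x) (ULift.up y)
            map_smul' a x := ?_ }, fun x => congrArg ULift.down (LinearMap.congr_fun hs (ULift.up x))⟩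
  -- `a ⊗ 1` acts as `a` on both modules, so the `Λ`-linear section is `A`-linear.
  have := s.map_smul (a ⊗ₜ[k] 1) (ULift.up x)
  change s (π (a ⊗ₜ[k] 1) • ULift.up x) = π (a ⊗ₜ[k] 1) • s (ULift.up x) at this
  rw [hπ] at this
  exact this
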